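/- Let $H_1, H_2$ be infinite-dimensional separable complex Hilbert spaces. A bounded operator $T : E \to F$ between Hilbert spaces is called absolutely norm attaining if for every nonzero closed subspace $M \subseteq E$ there is $x \in M$ with $\|x\| = 1$ and $\|Tx\| = \|T|_M\|$; let $\mathcal{AN}(E,F)$ be the set of these operators, $\mathcal{AN}(E) = \mathcal{AN}(E,E)$, and let $\overline{\mathcal{AN}(E)}$ be its closure in the operator norm. For a bounded operator $T$ on a Hilbert space put $|T| = (T^*T)^{1/2}$ and $\sigma_{ess}(T) = \{\mu \in \mathbb{C} : T - \mu I \text{ is not Fredholm}\}$, where an operator $S$ is Fredholm if its range is closed and the null spaces of $S$ and $S^*$ are finite-dimensional. Let $A_{ij} : H_j \to H_i$ $(i,j \in \{1,2\})$ be bounded operators. If $A_{11} \in \overline{\mathcal{AN}(H_1)}$, $A_{22} \in \overline{\mathcal{AN}(H_2)}$, $\sigma_{ess}(|A_{11}|) = \sigma_{ess}(|A_{22}|)$, and $A_{12}, A_{21}$ are compact, then $$T = \begin{bmatrix} A_{11} & A_{12} \\ A_{21} & A_{22} \end{bmatrix} \in \overline{\mathcal{AN}(H_1 \oplus H_2)},$$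 where $H_1 \oplus H_2$ is the Hilbert space direct sum and $T(x_1,x_2) = (A_{11}x_1 + A_{12}x_2,\; A_{21}x_1 + A_{22}x_2)$. -/

import Mathlib

namespace BlockAN

section Classes

variable {E F : Type*} [NormedAddCommGroup E] [NormedSpace ℂ E]
  [NormedAddCommGroup F] [NormedSpace ℂ F]

/-- `T` is norm attaining: `‖T x‖ = ‖T‖` for some unit vector `x`. -/
def IsNormAttaining (T : E →L[ℂ] F) : Prop :=
  ∃ x : E, ‖x‖ = 1 ∧ ‖T x‖ = ‖T‖

/-- `T` is absolutely norm attaining: its restriction to every nonzero closed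
subspace is norm attaining. -/
def IsAbsolutelyNormAttaining (T : E →L[ℂ] F) : Prop :=
  ∀ M : Submodule ℂ E, IsClosed (M : Set E) → M ≠ ⊥ → IsNormAttaining (T ∘L M.subtypeL)

variable (E F) in
/-- The class of absolutely norm attaining operators from `E` to `F`. Its `closure` is taken in
the topology of the operator norm, which is the one Mathlib puts on `E →L[ℂ] F`. -/
def AN : Set (E →L[ℂ] F) :=
  {T | IsAbsolutelyNormAttaining T}

end Classes

section Fredholm

variable {E : Type*} [NormedAddCommGroup E] [InnerProductSpace ℂ E] [CompleteSpace E]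

/-- On a Hilbert space, Mathlib's Fredholm operators are the operators with closed range such that
the null spaces of the operator and of its adjoint are finite dimensional. -/
theorem isFredholm_iff (T : E →L[ℂ] E) :
    T.IsFredholm ↔ IsClosed (T.range : Set E) ∧ FiniteDimensional ℂ T.ker ∧
      FiniteDimensional ℂ (ContinuousLinearMap.adjoint T).ker := by
  constructor
  · intro h
    refine ⟨h.isClosed_range, h.finite_ker, ?_⟩
    have hcl := h.isClosed_range
    have : CompleteSpace T.range := hcl.completeSpace_coe
    have hc := h.finite_coker
    rw [← ContinuousLinearMap.orthogonal_range]
    exact Module.Finite.iff_fg.2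
      (hc.fg_of_isCompl T.range.isCompl_orthogonal)
  · rintro ⟨hcl, hk, hk'⟩
    have : CompleteSpace T.range := hcl.completeSpace_coe
    rw [← ContinuousLinearMap.orthogonal_range] at hk'
    refine ⟨?_, hcl, hk, ?_, ?_⟩
    · have hs : Function.Surjective (T.codRestrict T.range fun x => ⟨x, rfl⟩) := by
        rintro ⟨_, x, rfl⟩
        exact ⟨x, rfl⟩
      exact (T.codRestrict T.range fun x => ⟨x, rfl⟩).isQuotientMap hs
    · exact (Module.Finite.iff_fg.1 hk').cofg_of_isCompl
        T.range.isCompl_orthogonal.symm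
    · exact Submodule.ClosedComplemented.of_finiteDimensional _

/-- The essential spectrum of `T`: the complex `μ` such that `T - μ I` is not Fredholm. -/
def essentialSpectrum (T : E →L[ℂ] E) : Set ℂ :=
  {μ | ¬ (T - μ • ContinuousLinearMap.id ℂ E).IsFredholm}

/-- The modulus `(T* T)^{1/2}` of `T`. -/
noncomputable def modulus (T : E →L[ℂ] E) : E →L[ℂ] E :=
  CFC.sqrt (ContinuousLinearMap.adjoint T ∘L T)

end Fredholm

section Block

variable {H₁ H₂ : Type*} [NormedAddCommGroup H₁] [InnerProductSpace ℂ H₁]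
  [NormedAddCommGroup H₂] [InnerProductSpace ℂ H₂]

/-- The operator on the Hilbert space direct sum `H₁ ⊕ H₂` with the block matrix
`[A₁₁, A₁₂; A₂₁, A₂₂]`. -/
noncomputable def blockOperator (A₁₁ : H₁ →L[ℂ] H₁) (A₁₂ : H₂ →L[ℂ] H₁)
    (A₂₁ : H₁ →L[ℂ] H₂) (A₂₂ : H₂ →L[ℂ] H₂) :
    WithLp 2 (H₁ × H₂) →L[ℂ] WithLp 2 (H₁ × H₂) :=
  (WithLp.prodContinuousLinearEquiv 2 ℂ H₁ H₂).symm.toContinuousLinearMap ∘L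
    ((A₁₁.coprod A₁₂).prod (A₂₁.coprod A₂₂)) ∘L
    (WithLp.prodContinuousLinearEquiv 2 ℂ H₁ H₂).toContinuousLinearMap

theorem blockOperator_apply (A₁₁ : H₁ →L[ℂ] H₁) (A₁₂ : H₂ →L[ℂ] H₁)
    (A₂₁ : H₁ →L[ℂ] H₂) (A₂₂ : H₂ →L[ℂ] H₂) (x₁ : H₁) (x₂ : H₂) :
    blockOperator A₁₁ A₁₂ A₂₁ A₂₂ (WithLp.toLp 2 (x₁, x₂)) =
      WithLp.toLp 2 (A₁₁ x₁ + A₁₂ x₂, A₂₁ x₁ + A₂₂ x₂) := rfl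

end Block

end BlockAN

/-! The closure of `AN` consists of exactly those `T` for which `T*T - βI` is compact for some `β ≥
0`. This condition survives compact perturbations and, when the two constants agree, direct sums.

Necessity (`exists_isCompactOperator_sub_of_mem_closure`): if `T*T` had infinite-dimensional
spectral parts both above `s` and below `t < s`, mixing vectors from the two would give an
orthonormal sequence along which `‖T x‖` strictly increases, and the norm would not be attained on
its closed span. So the spectrum of `T*T` clusters at one point `β`. Sufficiency
(`mem_closure_AN_of_isCompactOperator_sub`): flattening the spectrum near `β` moves `T` slightly and
makes `T*T - βI` finite rank, which forces `AN`.

Compactness of `|T|² - βI` makes `√β` the only possible real point of the essential spectrum of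
`|T|`, so equal essential spectra give equal constants (`eq_of_essentialSpectrum_eq`). The
off-diagonal blocks are a compact perturbation of the diagonal operator. -/

namespace BlockAN

open ContinuousLinearMap
open scoped InnerProductSpace

/-! ### Orthogonal combinations and finitely many linear constraints -/

section InnerProduct

variable {E : Type*} [NormedAddCommGroup E] [InnerProductSpace ℂ E]

theorem norm_sq_sqrt_smul_add {p : ℝ} (hp0 : 0 ≤ p) (hp1 : p ≤ 1) {a b : E}
    (hab : ⟪a, b⟫_ℂ = 0) : ‖((√p : ℝ) : ℂ) • a + ((√(1 - p) : ℝ) : ℂ) • b‖ ^ 2 =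
      p * ‖a‖ ^ 2 + (1 - p) * ‖b‖ ^ 2 := by
  rw [@norm_add_sq ℂ, inner_smul_left, inner_smul_right, hab, norm_smul, norm_smul,
    Complex.norm_real, Complex.norm_real, mul_pow, mul_pow,
    Real.norm_of_nonneg (Real.sqrt_nonneg _), Real.norm_of_nonneg (Real.sqrt_nonneg _),
    Real.sq_sqrt hp0, Real.sq_sqrt (by linarith)]
  simp

theorem exists_unit_mem_orthogonal_finset {V : Submodule ℂ E} (hV : ¬ FiniteDimensional ℂ V)
    (Z : Finset E) : ∃ u ∈ V, ‖u‖ = 1 ∧ ∀ z ∈ Z, ⟪z, u⟫_ℂ = 0 := by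
  let φ : V →ₗ[ℂ] (Z → ℂ) := LinearMap.pi fun z => (innerSL ℂ (z : E)).toLinearMap ∘ₗ V.subtype
  have hφ : ¬ Function.Injective φ := fun h => hV (Module.Finite.of_injective φ h)
  rw [← LinearMap.ker_eq_bot, Submodule.eq_bot_iff] at hφ
  push Not at hφ
  obtain ⟨v, hv, hv0⟩ := hφ
  have hv0' : (v : E) ≠ 0 := by simpa using hv0
  refine ⟨(‖(v : E)‖⁻¹ : ℂ) • (v : E), V.smul_mem _ v.2, ?_, fun z hz => ?_⟩
  · simpa using norm_smul_inv_norm (𝕜 := ℂ) hv0'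
  · have : φ v ⟨z, hz⟩ = 0 := by rw [LinearMap.mem_ker.1 hv]; rfl
    rw [inner_smul_right]
    simp only [φ, LinearMap.pi_apply, LinearMap.comp_apply] at this
    exact mul_eq_zero_of_right _ this

end InnerProduct

/-! ### Obstructions to absolute norm attainment -/

section Obstruction

variable {E F : Type*} [NormedAddCommGroup E] [InnerProductSpace ℂ E] [CompleteSpace E]
  [NormedAddCommGroup F] [InnerProductSpace ℂ F] [CompleteSpace F]

/-- A maximizing vector is an eigenvector of `T*T` for `‖T‖²`: expanding `‖T*T x - ‖T‖² x‖²` gives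
something at most `0`. -/
theorem inner_map_map_of_norm_map_eq (T : E →L[ℂ] F) {x : E} (hx : ‖T x‖ = ‖T‖ * ‖x‖) (y : E) :
    ⟪T x, T y⟫_ℂ = ((‖T‖ ^ 2 : ℝ) : ℂ) * ⟪x, y⟫_ℂ := by
  have key : adjoint T (T x) = ((‖T‖ ^ 2 : ℝ) : ℂ) • x := by
    rw [← sub_eq_zero, ← norm_eq_zero, ← sq_eq_zero_iff]
    have h1 : ‖adjoint T (T x)‖ ≤ ‖T‖ * (‖T‖ * ‖x‖) := by
      calc ‖adjoint T (T x)‖ ≤ ‖adjoint T‖ * ‖T x‖ := le_opNorm _ _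
        _ = _ := by rw [hx, LinearIsometryEquiv.norm_map]
    have h2 : ‖adjoint T (T x)‖ ^ 2 ≤ (‖T‖ * (‖T‖ * ‖x‖)) ^ 2 := by gcongr
    have h3 : RCLike.re ⟪adjoint T (T x), ((‖T‖ ^ 2 : ℝ) : ℂ) • x⟫_ℂ
        = ‖T‖ ^ 2 * (‖T‖ * ‖x‖) ^ 2 := by
      rw [inner_smul_right, adjoint_inner_left, inner_self_eq_norm_sq_to_K, hx]
      norm_cast
      change (((‖T‖ ^ 2 : ℝ) : ℂ) * (((‖T‖ * ‖x‖) ^ 2 : ℝ) : ℂ)).re = _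
      rw [Complex.re_ofReal_mul, Complex.ofReal_re]
    have h4 : ‖((‖T‖ ^ 2 : ℝ) : ℂ) • x‖ = ‖T‖ ^ 2 * ‖x‖ := by
      rw [norm_smul, Complex.norm_real, Real.norm_of_nonneg (by positivity)]
    refine le_antisymm ?_ (sq_nonneg _)
    rw [@norm_sub_sq ℂ, h3, h4]
    nlinarith
  rw [← adjoint_inner_left, key, inner_smul_left, Complex.conj_ofReal]

/-- On the closed span of the `x n` the form `⟪T ·, T ·⟫` is diagonal with entries `‖T (x n)‖²`. All
of these lie strictly below the squared norm of the restriction, so a maximizing vector, being an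
eigenvector for that value, is orthogonal to every `x n` and vanishes. -/
theorem not_isAbsolutelyNormAttaining_of_orthonormal {T : E →L[ℂ] F} {x : ℕ → E}
    (hx : Orthonormal ℂ x) (hT : Pairwise fun m n => ⟪T (x m), T (x n)⟫_ℂ = 0)
    (hmono : StrictMono fun n => ‖T (x n)‖) : ¬ IsAbsolutelyNormAttaining T := by
  intro h
  set M := (Submodule.span ℂ (Set.range x)).topologicalClosure with hM
  have hMc : IsClosed (M : Set E) := Submodule.isClosed_topologicalClosure _
  have : CompleteSpace M := hMc.completeSpace_coe
  have hxM : ∀ n, x n ∈ M := fun n =>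
    Submodule.le_topologicalClosure _ (Submodule.subset_span ⟨n, rfl⟩)
  have hM0 : M ≠ ⊥ := by
    intro h0
    have := hxM 0
    rw [h0, Submodule.mem_bot] at this
    exact hx.ne_zero 0 this
  obtain ⟨z, hz, hzT⟩ := h M hMc hM0
  set R := T ∘L M.subtypeL with hR
  have hattain := inner_map_map_of_norm_map_eq R (x := z) (by rw [hz, mul_one, hzT])
  have eig : ∀ n, ∀ y ∈ M, ⟪T (x n), T y⟫_ℂ = ((‖T (x n)‖ ^ 2 : ℝ) : ℂ) * ⟪x n, y⟫_ℂ := by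
    intro n y hy
    have hcl : IsClosed {y | ⟪T (x n), T y⟫_ℂ = ((‖T (x n)‖ ^ 2 : ℝ) : ℂ) * ⟪x n, y⟫_ℂ} :=
      isClosed_eq (by fun_prop) (by fun_prop)
    refine closure_minimal ?_ hcl hy
    intro y hy
    induction hy using Submodule.span_induction with
    | mem y hy =>
      obtain ⟨m, rfl⟩ := hy
      by_cases hmn : n = m
      · subst hmn
        simp [inner_self_eq_norm_sq_to_K, hx.1]
      · have h0 : ⟪x n, x m⟫_ℂ = 0 := hx.2 hmn
        simp [hT hmn, h0]
    | zero => simp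
    | add y y' _ _ h1 h2 =>
      simp only [Set.mem_ofPred_eq] at *
      rw [map_add, inner_add_right, inner_add_right, h1, h2, mul_add]
    | smul c y _ h1 =>
      simp only [Set.mem_ofPred_eq] at *
      rw [map_smul, inner_smul_right, inner_smul_right, h1]
      ring
  have horth : ∀ n, ⟪x n, (z : E)⟫_ℂ = 0 := by
    intro n
    have h1 := eig n z z.2
    have h2 := hattain ⟨x n, hxM n⟩
    have h3 : ⟪T (x n), T z⟫_ℂ = ((‖R‖ ^ 2 : ℝ) : ℂ) * ⟪x n, (z : E)⟫_ℂ := by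
      have := congrArg (starRingEnd ℂ) h2
      rw [map_mul, Complex.conj_ofReal, inner_conj_symm, inner_conj_symm] at this
      exact this
    have hlt : ‖T (x n)‖ < ‖R‖ := by
      refine (hmono (Nat.lt_succ_self n)).trans_le ?_
      have := R.le_opNorm ⟨x (n + 1), hxM _⟩
      simpa [hR, hx.1] using this
    have h5 : (‖T (x n)‖ ^ 2 : ℝ) < ‖R‖ ^ 2 := by gcongr
    have h4 : (((‖T (x n)‖ ^ 2 : ℝ) : ℂ) - ((‖R‖ ^ 2 : ℝ) : ℂ)) * ⟪x n, (z : E)⟫_ℂ = 0 := by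
      rw [sub_mul, ← h1, ← h3, sub_self]
    refine (mul_eq_zero.1 h4).resolve_left ?_
    rw [← Complex.ofReal_sub, Complex.ofReal_eq_zero]
    linarith
  have hzz : ⟪(z : E), (z : E)⟫_ℂ = 0 := by
    have hcl : IsClosed {y | ⟪y, (z : E)⟫_ℂ = 0} := isClosed_eq (by fun_prop) (by fun_prop)
    refine closure_minimal ?_ hcl z.2
    intro y hy
    induction hy using Submodule.span_induction with
    | mem y hy =>
      obtain ⟨m, rfl⟩ := hy
      exact horth m
    | zero => simp
    | add y y' _ _ h1 h2 =>
      simp only [Set.mem_ofPred_eq] at *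
      rw [inner_add_left, h1, h2, add_zero]
    | smul c y _ h1 =>
      simp only [Set.mem_ofPred_eq] at *
      rw [inner_smul_left, h1, mul_zero]
  rw [inner_self_eq_zero] at hzz
  have : ‖(z : E)‖ = 1 := hz
  rw [hzz, norm_zero] at this
  exact zero_ne_one this

theorem not_isAbsolutelyNormAttaining_of_submodules {T : E →L[ℂ] F} {V W : Submodule ℂ E}
    (hV : ¬ FiniteDimensional ℂ V) (hW : ¬ FiniteDimensional ℂ W)
    (hVW : ∀ v ∈ V, ∀ w ∈ W, ⟪v, w⟫_ℂ = 0) (hTVW : ∀ v ∈ V, ∀ w ∈ W, ⟪T v, T w⟫_ℂ = 0)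
    {s t : ℝ} (hts : t < s) (hs : ∀ v ∈ V, s * ‖v‖ ^ 2 ≤ ‖T v‖ ^ 2)
    (ht : ∀ w ∈ W, ‖T w‖ ^ 2 ≤ t * ‖w‖ ^ 2) : ¬ IsAbsolutelyNormAttaining T := by
  classical
  obtain ⟨x, hP, hr⟩ := exists_seq_of_forall_finset_exists
    (fun x : E => ‖x‖ = 1 ∧ ‖T x‖ ^ 2 < s)
    (fun x y => ⟪x, y⟫_ℂ = 0 ∧ ⟪T x, T y⟫_ℂ = 0 ∧ ‖T x‖ ^ 2 < ‖T y‖ ^ 2) (by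
      intro Z hZ
      -- `c` is the prescribed value of `‖T x‖²` at the next vector. Staying strictly below `s`
      -- leaves room for all later ones.
      obtain ⟨c, hc, hct, hcs⟩ : ∃ c, (∀ z ∈ Z, ‖T z‖ ^ 2 < c) ∧ t < c ∧ c < s := by
        clear hVW hTVW hs ht
        induction Z using Finset.induction_on with
        | empty => exact ⟨(t + s) / 2, by simp, by linarith, by linarith⟩
        | insert z Z hz ih =>
          obtain ⟨c, hc, hct, hcs⟩ := ih fun x hx => hZ x (Finset.mem_insert_of_mem hx)
          obtain ⟨d, hd, hds⟩ := exists_between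
            (max_lt hcs (hZ z (Finset.mem_insert_self _ _)).2)
          refine ⟨d, fun y hy => ?_, hct.trans ((le_max_left _ _).trans_lt hd), hds⟩
          rcases Finset.mem_insert.1 hy with rfl | hy
          · exact (le_max_right _ _).trans_lt hd
          · exact (hc y hy).trans ((le_max_left _ _).trans_lt hd)
      -- Orthogonality to `T*T z` makes the image of the new vector orthogonal to `T z`.
      set Z' := Z ∪ Z.image fun z => adjoint T (T z) with hZ'
      obtain ⟨u, huV, hu1, hu⟩ := exists_unit_mem_orthogonal_finset hV Z'
      obtain ⟨w, hwW, hw1, hw⟩ := exists_unit_mem_orthogonal_finset hW Z'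
      have hqu : s ≤ ‖T u‖ ^ 2 := by simpa [hu1] using hs u huV
      have hqw : ‖T w‖ ^ 2 ≤ t := by simpa [hw1] using ht w hwW
      -- The weight solving `p‖T u‖² + (1 - p)‖T w‖² = c`.
      set p := (c - ‖T w‖ ^ 2) / (‖T u‖ ^ 2 - ‖T w‖ ^ 2) with hp
      have hden : 0 < ‖T u‖ ^ 2 - ‖T w‖ ^ 2 := by linarith
      have hp0 : 0 ≤ p := div_nonneg (by linarith) hden.le
      have hp1 : p ≤ 1 := (div_le_one hden).2 (by linarith)
      have hpc : p * ‖T u‖ ^ 2 + (1 - p) * ‖T w‖ ^ 2 = c := by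
        have : p * (‖T u‖ ^ 2 - ‖T w‖ ^ 2) = c - ‖T w‖ ^ 2 := div_mul_cancel₀ _ hden.ne'
        linarith
      refine ⟨((√p : ℝ) : ℂ) • u + ((√(1 - p) : ℝ) : ℂ) • w, ⟨?_, ?_⟩, fun z hz => ⟨?_, ?_, ?_⟩⟩
      · have := norm_sq_sqrt_smul_add hp0 hp1 (hVW u huV w hwW)
        rw [hu1, hw1] at this
        have h1 : ‖((√p : ℝ) : ℂ) • u + ((√(1 - p) : ℝ) : ℂ) • w‖ ^ 2 = 1 := by linarith
        exact (pow_eq_one_iff_of_nonneg (norm_nonneg _) two_ne_zero).1 h1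
      · rw [map_add, map_smul, map_smul, norm_sq_sqrt_smul_add hp0 hp1 (hTVW u huV w hwW), hpc]
        exact hcs
      · have hzZ : z ∈ Z' := Finset.mem_union_left _ hz
        rw [inner_add_right, inner_smul_right, inner_smul_right, hu z hzZ, hw z hzZ]
        simp
      · have hzZ : adjoint T (T z) ∈ Z' := Finset.mem_union_right _ (Finset.mem_image_of_mem _ hz)
        rw [← adjoint_inner_left, inner_add_right, inner_smul_right, inner_smul_right, hu _ hzZ,
          hw _ hzZ]
        simp
      · rw [map_add, map_smul, map_smul, norm_sq_sqrt_smul_add hp0 hp1 (hTVW u huV w hwW), hpc]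
        exact hc z hz)
  refine not_isAbsolutelyNormAttaining_of_orthonormal (x := x) ⟨fun n => (hP n).1, ?_⟩ ?_ ?_
  · intro m n hmn
    rcases lt_or_gt_of_ne hmn with h | h
    · exact (hr m n h).1
    · exact inner_eq_zero_symm.1 (hr n m h).1
  · intro m n hmn
    rcases lt_or_gt_of_ne hmn with h | h
    · exact (hr m n h).2.1
    · exact inner_eq_zero_symm.1 (hr n m h).2.1
  · intro m n hmn
    exact lt_of_pow_lt_pow_left₀ 2 (norm_nonneg _) (hr m n hmn).2.2

end Obstruction

/-! ### Finite-rank operators from the functional calculus -/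

section FiniteRank

theorem isCompactOperator_of_finiteDimensional_range {E : Type*} [NormedAddCommGroup E]
    [InnerProductSpace ℂ E] {A : E →L[ℂ] E}
    (h : FiniteDimensional ℂ A.range) : IsCompactOperator A := by
  have : ProperSpace A.range := FiniteDimensional.proper ℂ A.range
  exact (isCompactOperator_id.comp_clm A.rangeRestrict).clm_comp A.range.subtypeL

variable {E : Type*} [NormedAddCommGroup E] [InnerProductSpace ℂ E] [CompleteSpace E]

theorem isCompactOperator_of_forall_norm_sub_le {A : E →L[ℂ] E}
    (h : ∀ ε > 0, ∃ G : E →L[ℂ] E, IsCompactOperator G ∧ ‖A - G‖ ≤ ε) : IsCompactOperator A := by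
  have hc : IsClosed {f : E →L[ℂ] E | IsCompactOperator f} := isClosed_setOfPred_isCompactOperator
  refine hc.closure_subset (Metric.mem_closure_iff.2 fun ε hε => ?_)
  obtain ⟨G, hG, hAG⟩ := h (ε / 2) (half_pos hε)
  exact ⟨G, hG, by rw [dist_eq_norm]; linarith⟩

/-- Here `p` is a continuous function equal to `1/q` where `|q| ≥ δ`. Hence the compact operator
`q(B)p(B)` is the identity on the range of `f(B)`, which therefore lies in a finite-dimensional
eigenspace. -/
theorem finiteDimensional_range_cfc {B : E →L[ℂ] E} {q f : ℝ → ℝ}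
    (hq : Continuous q) (hf : Continuous f) (hc : IsCompactOperator (cfc q B : E →L[ℂ] E)) {δ : ℝ}
    (hδ : 0 < δ) (h : ∀ x ∈ spectrum ℝ B, |q x| < δ → f x = 0) :
    FiniteDimensional ℂ (cfc f B).range := by
  set p : ℝ → ℝ := fun x => q x / max (δ ^ 2) (q x ^ 2) with hp
  have hpc : Continuous p := by
    refine hq.div (by fun_prop) fun x => ?_
    have := le_max_left (δ ^ 2) (q x ^ 2)
    positivity
  have hmul : cfc q B * cfc p B * cfc f B = cfc f B := by
    rw [← cfc_mul q p B, ← cfc_mul _ f B]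
    refine cfc_congr fun x hx => ?_
    by_cases hqx : |q x| < δ
    · simp [h x hx hqx]
    · have hle : δ ^ 2 ≤ q x ^ 2 := by
        rw [← sq_abs (q x)]
        gcongr
        exact not_lt.1 hqx
      have h0 : q x ≠ 0 := by
        intro h0
        rw [h0, abs_zero] at hqx
        exact hqx hδ
      simp only [hp, max_eq_right hle]
      field_simp
  have hQ : IsCompactOperator (cfc q B * cfc p B : E →L[ℂ] E) := hc.comp_clm (cfc p B)
  have := ContinuousLinearMap.finite_dimensional_eigenspace hQ 1 one_ne_zero
  refine Submodule.finiteDimensional_of_le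
    (S₂ := Module.End.eigenspace (cfc q B * cfc p B).toLinearMap 1) ?_
  rintro _ ⟨x, rfl⟩
  rw [Module.End.mem_eigenspace_iff, one_smul]
  exact DFunLike.congr_fun hmul x

theorem cfc_sub_const_eq {B : E →L[ℂ] E} (hB : IsSelfAdjoint B) (r : ℝ) :
    cfc (fun x : ℝ => x - r) B = B - r • (1 : E →L[ℂ] E) := by
  rw [cfc_sub (fun x => x) (fun _ => r) B, cfc_id' ℝ B, cfc_const r B,
    Algebra.algebraMap_eq_smul_one]

theorem cfc_sq_sub_const_eq {B : E →L[ℂ] E} (hB : IsSelfAdjoint B) (r : ℝ) :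
    cfc (fun x : ℝ => x * x - r) B = B * B - r • (1 : E →L[ℂ] E) := by
  rw [cfc_sub (fun x => x * x) (fun _ => r) B, cfc_mul (fun x => x) (fun x => x) B, cfc_id' ℝ B,
    cfc_const r B, Algebra.algebraMap_eq_smul_one]

end FiniteRank

/-! ### Recovering the constant from the essential spectrum -/

section EssentialSpectrum

open scoped LinearMap.FiniteRangeSetoid

theorem isFredholm_of_finiteDimensional_range {E : Type*} [NormedAddCommGroup E]
    [InnerProductSpace ℂ E] {T v : E →L[ℂ] E}
    (h1 : FiniteDimensional ℂ (v * T - 1).range) (h2 : FiniteDimensional ℂ (T * v - 1).range) :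
    T.IsFredholm := by
  refine IsFredholm.of_isQuasiInverse (v := v) ⟨?_, ?_⟩
  · change v.toLinearMap ∘ₗ T.toLinearMap ≈ LinearMap.id
    rw [LinearMap.FiniteRangeSetoid.equiv_iff_hasNoetherianRange,
      LinearMap.hasNoetherianRange_iff_range]
    exact IsNoetherian.iff_fg.2 h1
  · change T.toLinearMap ∘ₗ v.toLinearMap ≈ LinearMap.id
    rw [LinearMap.FiniteRangeSetoid.equiv_iff_hasNoetherianRange,
      LinearMap.hasNoetherianRange_iff_range]
    exact IsNoetherian.iff_fg.2 h2

/-- A Fredholm operator is invertible modulo finite rank; if it were also compact, the identity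
would be compact. -/
theorem mem_essentialSpectrum_of_isCompactOperator {E : Type*}
    [NormedAddCommGroup E] [InnerProductSpace ℂ E] (hE : ¬ FiniteDimensional ℂ E) {B : E →L[ℂ] E}
    {μ : ℂ} (h : IsCompactOperator (B - μ • ContinuousLinearMap.id ℂ E : E →L[ℂ] E)) :
    μ ∈ essentialSpectrum B := by
  intro hF
  obtain ⟨v, hv⟩ := hF.exists_isQuasiInverse
  set D := B - μ • ContinuousLinearMap.id ℂ E with hD
  have h1 := hv.1.equiv
  rw [LinearMap.FiniteRangeSetoid.equiv_iff_hasNoetherianRange,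
    LinearMap.hasNoetherianRange_iff_range] at h1
  have h2 : FiniteDimensional ℂ (v ∘L D - ContinuousLinearMap.id ℂ E).range :=
    IsNoetherian.iff_fg.1 h1
  have h3 := isCompactOperator_of_finiteDimensional_range h2
  have h4 := (h.clm_comp v).sub h3
  refine hE (FiniteDimensional.of_isCompactOperator_id (𝕜 := ℂ) ?_)
  have h5 : (id : E → E) = ⇑v ∘ ⇑D - ⇑(v ∘L D - ContinuousLinearMap.id ℂ E) := by
    funext x
    simp
  rwa [h5]

variable {E : Type*} [NormedAddCommGroup E] [InnerProductSpace ℂ E] [CompleteSpace E]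

theorem sq_abs_sub_sqrt_le {x β : ℝ} (hx : 0 ≤ x) (hβ : 0 ≤ β) :
    |x - √β| ^ 2 ≤ |x * x - β| := by
  have h2 : x * x - β = (x - √β) * (x + √β) := by
    nlinarith [Real.mul_self_sqrt hβ]
  rw [h2, abs_mul, sq]
  refine mul_le_mul_of_nonneg_left ?_ (abs_nonneg _)
  rw [abs_of_nonneg (by positivity : 0 ≤ x + √β), abs_le]
  constructor <;> linarith [Real.sqrt_nonneg β]

theorem isCompactOperator_sub_sqrt {B : E →L[ℂ] E} (hB : 0 ≤ B) {β : ℝ} (hβ : 0 ≤ β)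
    (h : IsCompactOperator (B * B - β • (1 : E →L[ℂ] E) : E →L[ℂ] E)) :
    IsCompactOperator (B - √β • (1 : E →L[ℂ] E) : E →L[ℂ] E) := by
  have hsa : IsSelfAdjoint B := .of_nonneg hB
  rw [← cfc_sq_sub_const_eq hsa] at h
  rw [← cfc_sub_const_eq hsa]
  refine isCompactOperator_of_forall_norm_sub_le fun ε hε => ?_
  -- Subtracting the truncation to `[-ε, ε]` costs at most `ε` in norm and leaves a function
  -- vanishing near `√β`, hence a finite-rank operator.
  set f : ℝ → ℝ := fun x => (x - √β) - max (-ε) (min ε (x - √β)) with hf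
  have hfc : Continuous f := by fun_prop
  refine ⟨cfc f B, isCompactOperator_of_finiteDimensional_range
    (finiteDimensional_range_cfc (q := fun x => x * x - β) (by fun_prop) hfc h (sq_pos_of_pos hε)
      fun x hx hxe => ?_), ?_⟩
  · have hx0 : 0 ≤ x := spectrum_nonneg_of_nonneg hB hx
    have h1 : |x - √β| < ε :=
      lt_of_pow_lt_pow_left₀ 2 hε.le ((sq_abs_sub_sqrt_le hx0 hβ).trans_lt hxe)
    rw [abs_lt] at h1
    simp only [hf]
    rw [min_eq_right h1.2.le, max_eq_right h1.1.le, sub_self]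
  · rw [← cfc_sub (fun x => x - √β) f B]
    refine norm_cfc_le hε.le fun x _ => ?_
    simp only [hf, sub_sub_cancel, Real.norm_eq_abs, abs_le]
    exact ⟨le_max_left _ _, max_le (by linarith) (min_le_left _ _)⟩

/-- A continuous truncation `v` of `1/(x - μ)`, exact within `η` of `√β`, gives an inverse of `B -
μ` up to an operator whose symbol vanishes near `√β`, hence up to finite rank. -/
theorem notMem_essentialSpectrum {B : E →L[ℂ] E} (hB : 0 ≤ B) {β μ : ℝ} (hβ : 0 ≤ β) (hμ : μ ≠ √β)
    (h : IsCompactOperator (B * B - β • (1 : E →L[ℂ] E) : E →L[ℂ] E)) :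
    (μ : ℂ) ∉ essentialSpectrum B := by
  have hsa : IsSelfAdjoint B := .of_nonneg hB
  rw [← cfc_sq_sub_const_eq hsa] at h
  rw [essentialSpectrum, Set.mem_ofPred_eq, not_not]
  have hT : B - (μ : ℂ) • ContinuousLinearMap.id ℂ E = cfc (fun x => x - μ) B := by
    rw [cfc_sub_const_eq hsa]
    rfl
  rw [hT]
  set η := |μ - √β| / 2 with hη
  have hη0 : 0 < η := by
    have := abs_pos.2 (sub_ne_zero.2 hμ)
    positivity
  obtain ⟨v, hv⟩ : ∃ v : ℝ → ℝ, v = fun x => (x - μ) / max (η ^ 2) ((x - μ) ^ 2) := ⟨_, rfl⟩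
  have hvc : Continuous v := by
    rw [hv]
    refine Continuous.div (by fun_prop) (by fun_prop) fun x => ?_
    have := le_max_left (η ^ 2) ((x - μ) ^ 2)
    positivity
  obtain ⟨g, hg⟩ : ∃ g : ℝ → ℝ, g = fun x => (x - μ) * v x - 1 := ⟨_, rfl⟩
  have hgc : Continuous g := by
    rw [hg]
    fun_prop
  have hgB : cfc (fun x => x - μ) B * cfc v B - 1 = cfc g B := by
    have hc : Continuous fun x : ℝ => x - μ := by fun_prop
    have hc' : Continuous fun x : ℝ => (x - μ) * v x := hc.mul hvc
    rw [hg, cfc_sub (fun x => (x - μ) * v x) (fun _ => (1 : ℝ)) B hc'.continuousOn,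
      cfc_mul (fun x => x - μ) v B hc.continuousOn hvc.continuousOn, cfc_const_one ℝ B]
  have hfin : FiniteDimensional ℂ (cfc g B).range := by
    refine finiteDimensional_range_cfc (q := fun x => x * x - β) (by fun_prop) hgc h
      (sq_pos_of_pos hη0) fun x hx hxe => ?_
    have hx0 : 0 ≤ x := spectrum_nonneg_of_nonneg hB hx
    have h1 : |x - √β| < η :=
      lt_of_pow_lt_pow_left₀ 2 hη0.le ((sq_abs_sub_sqrt_le hx0 hβ).trans_lt hxe)
    have h2 : η ≤ |x - μ| := by
      have := abs_sub_le μ x (√β)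
      rw [abs_sub_comm μ x] at this
      linarith
    have h3 : η ^ 2 ≤ (x - μ) ^ 2 := by
      rw [← sq_abs (x - μ)]
      gcongr
    have h4 : x - μ ≠ 0 := by
      intro h0
      rw [h0, abs_zero] at h2
      linarith
    simp only [hg, hv, max_eq_right h3]
    field_simp
    ring
  refine isFredholm_of_finiteDimensional_range (v := cfc v B) ?_ ?_
  · rwa [cfc_commute_cfc v (fun x => x - μ) B |>.eq, hgB]
  · rwa [hgB]

theorem eq_of_essentialSpectrum_eq {F : Type*} [NormedAddCommGroup F] [InnerProductSpace ℂ F]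
    [CompleteSpace F] (hE : ¬ FiniteDimensional ℂ E) {B : E →L[ℂ] E} {C : F →L[ℂ] F}
    (hB : 0 ≤ B) (hC : 0 ≤ C) (hBC : essentialSpectrum B = essentialSpectrum C) {β γ : ℝ}
    (hβ : 0 ≤ β) (hγ : 0 ≤ γ) (hBβ : IsCompactOperator (B * B - β • (1 : E →L[ℂ] E) : E →L[ℂ] E))
    (hCγ : IsCompactOperator (C * C - γ • (1 : F →L[ℂ] F) : F →L[ℂ] F)) : β = γ := by
  by_contra hne
  have h1 : ((√β : ℝ) : ℂ) ∈ essentialSpectrum B :=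
    mem_essentialSpectrum_of_isCompactOperator hE (isCompactOperator_sub_sqrt hB hβ hBβ)
  rw [hBC] at h1
  exact notMem_essentialSpectrum hC hγ (fun h => hne ((Real.sqrt_inj hβ hγ).1 h)) hCγ h1

theorem modulus_nonneg (T : E →L[ℂ] E) : 0 ≤ modulus T := CFC.sqrt_nonneg _

theorem modulus_mul_self (T : E →L[ℂ] E) : modulus T * modulus T = adjoint T ∘L T :=
  CFC.sqrt_mul_sqrt_self _ (star_mul_self_nonneg T)

end EssentialSpectrum

/-! ### From norm attainment to compactness of `T*T - βI` -/

section ANImpliesCompact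

variable {E : Type*} [NormedAddCommGroup E] [InnerProductSpace ℂ E] [CompleteSpace E]

theorem inner_cfc_left {A : E →L[ℂ] E} (f : ℝ → ℝ) (x y : E) :
    ⟪cfc f A x, y⟫_ℂ = ⟪x, cfc f A y⟫_ℂ := by
  have h : IsSelfAdjoint (cfc f A) := cfc_predicate f A
  conv_lhs => rw [← h.adjoint_eq]
  rw [adjoint_inner_left]

theorem adjoint_comp_self_nonneg (T : E →L[ℂ] E) : 0 ≤ adjoint T ∘L T :=
  star_mul_self_nonneg T

theorem inner_map_cfc_map_cfc (T : E →L[ℂ] E) {f g : ℝ → ℝ} (hf : Continuous f)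
    (hg : Continuous g) (x y : E) :
    ⟪T (cfc f (adjoint T ∘L T) x), T (cfc g (adjoint T ∘L T) y)⟫_ℂ =
      ⟪x, cfc (fun r => f r * r * g r) (adjoint T ∘L T) y⟫_ℂ := by
  have hsa : IsSelfAdjoint (adjoint T ∘L T) := .of_nonneg (adjoint_comp_self_nonneg T)
  rw [← adjoint_inner_right, inner_cfc_left,
    cfc_mul (fun r => f r * r) g _ (by fun_prop) (by fun_prop),
    cfc_mul f (fun r => r) _ (by fun_prop) (by fun_prop), cfc_id' ℝ (adjoint T ∘L T)]
  rfl

theorem inner_cfc_cfc (A : E →L[ℂ] E) {f g : ℝ → ℝ} (hf : Continuous f)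
    (hg : Continuous g) (x y : E) :
    ⟪cfc f A x, cfc g A y⟫_ℂ = ⟪x, cfc (fun r => f r * g r) A y⟫_ℂ := by
  rw [inner_cfc_left, cfc_mul f g _ (by fun_prop) (by fun_prop)]
  rfl

theorem norm_sq_map_cfc_sub (T : E →L[ℂ] E) {f : ℝ → ℝ} (hf : Continuous f) (s : ℝ) (x : E) :
    ‖T (cfc f (adjoint T ∘L T) x)‖ ^ 2 - s * ‖cfc f (adjoint T ∘L T) x‖ ^ 2 =
      RCLike.re ⟪x, cfc (fun r => (r - s) * f r ^ 2) (adjoint T ∘L T) x⟫_ℂ := by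
  have hfun : (fun r => (r - s) * f r ^ 2) = fun r => f r * r * f r - s • (f r * f r) := by
    funext r
    simp only [smul_eq_mul]
    ring
  rw [hfun, cfc_sub (fun r => f r * r * f r) (fun r => s • (f r * f r)) _ (by fun_prop)
    (by fun_prop), cfc_smul s (fun r => f r * f r) _ (by fun_prop), sub_apply,
    inner_sub_right, ← inner_map_cfc_map_cfc T hf hf, smul_apply,
    inner_smul_right_eq_smul, ← inner_cfc_cfc _ hf hf, map_sub, inner_self_eq_norm_sq_to_K,
    inner_self_eq_norm_sq_to_K]
  norm_cast

theorem re_inner_cfc_nonneg {A : E →L[ℂ] E} {f : ℝ → ℝ} (hf : ∀ r, 0 ≤ f r) (x : E) :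
    0 ≤ RCLike.re ⟪x, cfc f A x⟫_ℂ :=
  ((nonneg_iff_isPositive _).1 (cfc_nonneg fun r _ => hf r)).re_inner_nonneg_right x

/-- The two ranges stand in for the spectral subspaces of `T*T` above `s` and below `t`. The product
of the two functions is zero, so the ranges and their images under `T` are orthogonal. -/
theorem IsAbsolutelyNormAttaining.finiteDimensional_or {T : E →L[ℂ] E}
    (hT : IsAbsolutelyNormAttaining T) {s t : ℝ} (hts : t < s) :
    FiniteDimensional ℂ (cfc (fun r : ℝ => max (r - s) 0) (adjoint T ∘L T)).range ∨
      FiniteDimensional ℂ (cfc (fun r : ℝ => max (t - r) 0) (adjoint T ∘L T)).range := by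
  by_contra! hcon
  have hf : Continuous fun r : ℝ => max (r - s) 0 := by fun_prop
  have hg : Continuous fun r : ℝ => max (t - r) 0 := by fun_prop
  have hfg : ∀ r, max (r - s) 0 * max (t - r) 0 = 0 := by
    intro r
    rcases le_total r s with h | h
    · rw [max_eq_right (by linarith), zero_mul]
    · rw [max_eq_right (a := t - r) (by linarith), mul_zero]
  refine not_isAbsolutelyNormAttaining_of_submodules hcon.1 hcon.2 ?_ ?_ hts ?_ ?_ hT
  · rintro _ ⟨x, rfl⟩ _ ⟨y, rfl⟩
    refine (inner_cfc_cfc _ hf hg x y).trans ?_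
    simp [hfg]
  · rintro _ ⟨x, rfl⟩ _ ⟨y, rfl⟩
    refine (inner_map_cfc_map_cfc T hf hg x y).trans ?_
    simp [mul_right_comm _ _ (max _ _), hfg]
  · rintro _ ⟨x, rfl⟩
    rw [← sub_nonneg]
    refine (re_inner_cfc_nonneg (fun r => ?_) x).trans_eq (norm_sq_map_cfc_sub T hf s x).symm
    rcases le_total r s with h | h
    · rw [max_eq_right (by linarith)]
      simp
    · exact mul_nonneg (by linarith) (sq_nonneg _)
  · rintro _ ⟨x, rfl⟩
    rw [← sub_nonpos]
    refine (norm_sq_map_cfc_sub T hg t x).trans_le ?_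
    rw [← neg_nonneg, ← map_neg, ← inner_neg_right, ← neg_apply, ← cfc_neg]
    refine re_inner_cfc_nonneg (fun r => ?_) x
    rcases le_total t r with h | h
    · rw [max_eq_right (by linarith)]
      simp
    · nlinarith [mul_nonneg (sub_nonneg.2 h) (sq_nonneg (max (t - r) 0))]

/-- `β` is the infimum of the levels above which `T*T` has finite rank. The dichotomy then makes the
part below `β - ε` finite rank too. The bound by `‖T‖²` lets the constants converge along a
subsequence when passing to the closure. -/
theorem IsAbsolutelyNormAttaining.exists_isCompactOperator_sub {T : E →L[ℂ] E}
    (hT : IsAbsolutelyNormAttaining T) : ∃ β : ℝ, 0 ≤ β ∧ β ≤ ‖T‖ ^ 2 ∧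
      IsCompactOperator (adjoint T ∘L T - β • (1 : E →L[ℂ] E) : E →L[ℂ] E) := by
  set A := adjoint T ∘L T with hA
  have hA0 : 0 ≤ A := adjoint_comp_self_nonneg T
  have hsa : IsSelfAdjoint A := .of_nonneg hA0
  have hfin0 : ∀ f : ℝ → ℝ, (∀ r ∈ spectrum ℝ A, f r = 0) →
      FiniteDimensional ℂ (cfc f A).range := by
    intro f hf
    have h0 : cfc f A = 0 := by
      rw [cfc_congr (g := fun _ => 0) hf]
      exact cfc_const_zero ℝ A
    rw [h0]
    have : (0 : E →L[ℂ] E).range = ⊥ := LinearMap.range_zero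
    rw [this]
    infer_instance
  set D : Set ℝ := {s | 0 ≤ s ∧ FiniteDimensional ℂ (cfc (fun r : ℝ => max (r - s) 0) A).range}
    with hD
  have hTD : ‖T‖ ^ 2 ∈ D := by
    refine ⟨sq_nonneg _, hfin0 _ fun r hr => max_eq_right ?_⟩
    have h1 := spectrum.norm_le_norm_mul_of_mem hr
    have h2 : ‖A‖ = ‖T‖ * ‖T‖ := norm_adjoint_comp_self T
    have h3 : ‖(1 : E →L[ℂ] E)‖ ≤ 1 := norm_id_le
    have h4 : ‖A‖ * ‖(1 : E →L[ℂ] E)‖ ≤ ‖A‖ := mul_le_of_le_one_right (norm_nonneg _) h3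
    have h5 := Real.le_norm_self r
    rw [sq]
    linarith
  have hbdd : BddBelow D := ⟨0, fun s hs => hs.1⟩
  refine ⟨sInf D, le_csInf ⟨_, hTD⟩ fun s hs => hs.1, csInf_le hbdd hTD, ?_⟩
  set β := sInf D with hβ
  refine isCompactOperator_of_forall_norm_sub_le fun ε hε => ?_
  obtain ⟨s, hsD, hs⟩ := exists_lt_of_csInf_lt ⟨_, hTD⟩ (show sInf D < β + ε by linarith)
  have hβs : β ≤ s := csInf_le hbdd hsD
  have hfin : FiniteDimensional ℂ (cfc (fun r : ℝ => max (β - ε - r) 0) A).range := by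
    by_cases hneg : β - ε / 2 < 0
    · refine hfin0 _ fun r hr => max_eq_right ?_
      have : 0 ≤ r := spectrum_nonneg_of_nonneg hA0 hr
      linarith
    · have hnot : β - ε / 2 ∉ D := fun h => by
        have := csInf_le hbdd h
        linarith
      refine (hT.finiteDimensional_or (s := β - ε / 2) (t := β - ε) (by linarith)).resolve_left ?_
      exact fun h => hnot ⟨not_lt.1 hneg, h⟩
  -- Removing these two tails clamps the spectrum to `[β - ε, s]`, within `ε` of `β`.
  refine ⟨cfc (fun r : ℝ => max (r - s) 0) A - cfc (fun r : ℝ => max (β - ε - r) 0) A,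
    (isCompactOperator_of_finiteDimensional_range hsD.2).sub
      (isCompactOperator_of_finiteDimensional_range hfin), ?_⟩
  rw [← cfc_sub_const_eq hsa, ← cfc_sub (fun r : ℝ => max (r - s) 0) _ A (by fun_prop)
    (by fun_prop), ← cfc_sub (fun r : ℝ => r - β) _ A (by fun_prop) (by fun_prop)]
  refine norm_cfc_le hε.le fun r _ => ?_
  rw [Real.norm_eq_abs, abs_le]
  rcases le_total r s with h | h <;> rcases le_total (β - ε) r with h' | h'
  · rw [max_eq_right (by linarith : r - s ≤ 0), max_eq_right (by linarith : β - ε - r ≤ 0)]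
    constructor <;> linarith
  · rw [max_eq_right (by linarith : r - s ≤ 0), max_eq_left (by linarith : 0 ≤ β - ε - r)]
    constructor <;> linarith
  · rw [max_eq_left (by linarith : 0 ≤ r - s), max_eq_right (by linarith : β - ε - r ≤ 0)]
    constructor <;> linarith
  · linarith

theorem exists_isCompactOperator_sub_of_mem_closure {T : E →L[ℂ] E} (hT : T ∈ closure (AN E E)) :
    ∃ β : ℝ, 0 ≤ β ∧
      IsCompactOperator (adjoint T ∘L T - β • (1 : E →L[ℂ] E) : E →L[ℂ] E) := by
  obtain ⟨u, hu, hlim⟩ := mem_closure_iff_seq_limit.1 hT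
  choose β hβ0 hβ hβc using fun n => IsAbsolutelyNormAttaining.exists_isCompactOperator_sub (hu n)
  obtain ⟨C, hC⟩ := hlim.norm.bddAbove_range
  obtain ⟨b, hb, φ, hφ, hφlim⟩ := isCompact_Icc.tendsto_subseq (x := β) (s := Set.Icc 0 (C ^ 2))
    fun n => ⟨hβ0 n, (hβ n).trans (by gcongr; exact hC ⟨n, rfl⟩)⟩
  refine ⟨b, hb.1, isCompactOperator_of_tendsto (l := Filter.atTop)
    (F := fun n => adjoint (u (φ n)) ∘L u (φ n) - β (φ n) • (1 : E →L[ℂ] E)) ?_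
    (Filter.Eventually.of_forall fun n => hβc (φ n))⟩
  have h1 : Filter.Tendsto (fun n => u (φ n)) Filter.atTop (nhds T) :=
    hlim.comp hφ.tendsto_atTop
  have h2 : Filter.Tendsto (fun n => star (u (φ n)) * u (φ n)) Filter.atTop
      (nhds (star T * T)) := h1.star.mul h1
  exact h2.sub (hφlim.smul_const _)

end ANImpliesCompact

/-! ### From compactness of `T*T - βI` to the closure of `AN` -/

section CompactImpliesAN

theorem isNormAttaining_of_le {E F : Type*} [NormedAddCommGroup E]
    [NormedSpace ℂ E] [NormedAddCommGroup F] [NormedSpace ℂ F] {S : E →L[ℂ] F} {x : E}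
    (hx : x ≠ 0) (h : ‖S‖ ^ 2 * ‖x‖ ^ 2 ≤ ‖S x‖ ^ 2) : IsNormAttaining S := by
  have hx' : 0 < ‖x‖ := norm_pos_iff.2 hx
  have h1 : ‖S x‖ = ‖S‖ * ‖x‖ := by
    refine le_antisymm (S.le_opNorm x) (le_of_sq_le_sq ?_ (norm_nonneg _))
    rwa [mul_pow]
  refine ⟨(‖x‖⁻¹ : ℂ) • x, by simpa using norm_smul_inv_norm (𝕜 := ℂ) hx, ?_⟩
  rw [map_smul, norm_smul, h1, norm_inv, Complex.norm_real, norm_norm]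
  field_simp

variable {E : Type*} [NormedAddCommGroup E] [InnerProductSpace ℂ E] [CompleteSpace E]
  {F : Type*} [NormedAddCommGroup F] [InnerProductSpace ℂ F] [CompleteSpace F]

/-- `‖S‖²` lies in the spectrum of `S*S`; after the shift by `γ` it is a nonzero spectral point of a
compact operator, hence an eigenvalue. -/
theorem isNormAttaining_of_isCompactOperator_sub [Nontrivial E] {S : E →L[ℂ] F} {γ : ℝ}
    (hγ : ‖S‖ ^ 2 ≠ γ)
    (h : IsCompactOperator (adjoint S ∘L S - γ • (1 : E →L[ℂ] E) : E →L[ℂ] E)) :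
    IsNormAttaining S := by
  set C := adjoint S ∘L S with hC
  have hC0 : 0 ≤ C := (nonneg_iff_isPositive _).2 (isPositive_adjoint_comp_self S)
  have hCn : ‖C‖ = ‖S‖ ^ 2 := by rw [sq]; exact norm_adjoint_comp_self S
  have h1 : ‖S‖ ^ 2 ∈ spectrum ℝ C := by
    rw [← hCn]
    exact CStarAlgebra.norm_mem_spectrum_of_nonneg hC0
  have h2 : ((‖S‖ ^ 2 : ℝ) : ℂ) ∈ spectrum ℂ C := spectrum.algebraMap_mem ℂ h1
  have h3 : ((‖S‖ ^ 2 : ℝ) : ℂ) - (γ : ℂ) ∈ spectrum ℂ (C - algebraMap ℂ (E →L[ℂ] E) γ) := by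
    rw [← spectrum.sub_singleton_eq]
    exact Set.sub_mem_sub h2 rfl
  have h4 : algebraMap ℂ (E →L[ℂ] E) γ = γ • (1 : E →L[ℂ] E) := by
    rw [Algebra.algebraMap_eq_smul_one, Complex.coe_smul]
  have h5 : ((‖S‖ ^ 2 : ℝ) : ℂ) - (γ : ℂ) ≠ 0 := by
    rw [← Complex.ofReal_sub, Ne, Complex.ofReal_eq_zero]
    exact sub_ne_zero.2 hγ
  rw [h4, ← h.hasEigenvalue_iff_mem_spectrum h5] at h3
  obtain ⟨x, hx⟩ := h3.exists_hasEigenvector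
  have h6 : C x - (γ : ℂ) • x = (((‖S‖ ^ 2 : ℝ) : ℂ) - (γ : ℂ)) • x := hx.apply_eq_smul
  rw [sub_smul, sub_left_inj] at h6
  refine isNormAttaining_of_le hx.2 ?_
  rw [apply_norm_sq_eq_inner_adjoint_left S x, ← hC, h6, inner_smul_left, Complex.conj_ofReal,
    inner_self_eq_norm_sq_to_K]
  norm_cast
  change _ ≤ (((‖S‖ ^ 2 : ℝ) : ℂ) * ((‖x‖ ^ 2 : ℝ) : ℂ)).re
  rw [Complex.re_ofReal_mul, Complex.ofReal_re]

/-- Compactness passes to the compression to `M`, which settles every case except `‖R|_M‖² = β`;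
`hM` supplies a maximizing vector there. -/
theorem isAbsolutelyNormAttaining_of_isCompactOperator_sub {R : E →L[ℂ] F} {β : ℝ}
    (h : IsCompactOperator (adjoint R ∘L R - β • (1 : E →L[ℂ] E) : E →L[ℂ] E))
    (hM : ∀ M : Submodule ℂ E, ¬ FiniteDimensional ℂ M →
      ∃ x ∈ M, x ≠ 0 ∧ β * ‖x‖ ^ 2 ≤ ‖R x‖ ^ 2) :
    IsAbsolutelyNormAttaining R := by
  intro M hMc hM0
  have : CompleteSpace M := hMc.completeSpace_coe
  have : Nontrivial M := Submodule.nontrivial_iff_ne_bot.2 hM0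
  set S := R ∘L M.subtypeL with hS
  by_cases hfin : FiniteDimensional ℂ M
  · have : ProperSpace M := FiniteDimensional.proper ℂ M
    -- Every operator on a finite-dimensional space is compact, so any `γ ≠ ‖S‖²` would do.
    refine isNormAttaining_of_isCompactOperator_sub (γ := ‖S‖ ^ 2 + 1) (by linarith) ?_
    exact isCompactOperator_id.clm_comp _
  · by_cases hβ : ‖S‖ ^ 2 = β
    · obtain ⟨x, hxM, hx0, hx⟩ := hM M hfin
      refine isNormAttaining_of_le (x := ⟨x, hxM⟩) (by simpa using hx0) ?_
      rw [hβ]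
      exact hx
    · refine isNormAttaining_of_isCompactOperator_sub hβ ?_
      have heq : adjoint S ∘L S - β • (1 : M →L[ℂ] M) =
          adjoint M.subtypeL ∘L (adjoint R ∘L R - β • (1 : E →L[ℂ] E)) ∘L M.subtypeL := by
        ext1 x
        refine ext_inner_right ℂ fun y => ?_
        have e1 : ⟪(adjoint S ∘L S - β • (1 : M →L[ℂ] M)) x, y⟫_ℂ =
            ⟪R x, R y⟫_ℂ - (β : ℂ) * ⟪(x : E), (y : E)⟫_ℂ := by
          change ⟪adjoint S (S x) - (β : ℂ) • x, y⟫_ℂ = _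
          rw [inner_sub_left, adjoint_inner_left, inner_smul_left, Complex.conj_ofReal]
          rfl
        have e2 : ⟪(adjoint M.subtypeL ∘L (adjoint R ∘L R - β • (1 : E →L[ℂ] E)) ∘L
            M.subtypeL) x, y⟫_ℂ = ⟪R x, R y⟫_ℂ - (β : ℂ) * ⟪(x : E), (y : E)⟫_ℂ := by
          change ⟪adjoint M.subtypeL (adjoint R (R x) - (β : ℂ) • (x : E)), y⟫_ℂ = _
          rw [adjoint_inner_left, inner_sub_left, adjoint_inner_left, inner_smul_left,
            Complex.conj_ofReal]
          rfl
        rw [e1, e2]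
      rw [heq]
      exact (h.comp_clm M.subtypeL).clm_comp (adjoint M.subtypeL)

/-- An infinite-dimensional `M` meets the kernel of the finite-rank `R*R - βI`, and there `‖R x‖² =
β‖x‖²`. -/
theorem isAbsolutelyNormAttaining_of_finiteDimensional_range {R : E →L[ℂ] F} {β : ℝ}
    (h : FiniteDimensional ℂ (adjoint R ∘L R - β • (1 : E →L[ℂ] E)).range) :
    IsAbsolutelyNormAttaining R := by
  set G := adjoint R ∘L R - β • (1 : E →L[ℂ] E) with hG
  refine isAbsolutelyNormAttaining_of_isCompactOperator_sub
    (isCompactOperator_of_finiteDimensional_range h) fun M hM => ?_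
  let φ : M →ₗ[ℂ] G.range := G.toLinearMap.rangeRestrict ∘ₗ M.subtype
  have hφ : ¬ Function.Injective φ := fun h => hM (Module.Finite.of_injective φ h)
  rw [← LinearMap.ker_eq_bot, Submodule.eq_bot_iff] at hφ
  push Not at hφ
  obtain ⟨x, hx, hx0⟩ := hφ
  have hGx : adjoint R (R x) - (β : ℂ) • (x : E) = 0 :=
    congrArg Subtype.val (LinearMap.mem_ker.1 hx)
  refine ⟨x, x.2, by simpa using hx0, ?_⟩
  rw [apply_norm_sq_eq_inner_adjoint_left R x]
  change _ ≤ RCLike.re ⟪adjoint R (R x), (x : E)⟫_ℂ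
  rw [sub_eq_zero.1 hGx, inner_smul_left, Complex.conj_ofReal, inner_self_eq_norm_sq_to_K]
  norm_cast
  change _ ≤ ((β : ℂ) * ((‖(x : E)‖ ^ 2 : ℝ) : ℂ)).re
  rw [Complex.re_ofReal_mul, Complex.ofReal_re]
  exact le_rfl

/-- For `β = 0` the operator is already in `AN`. For `β > 0`, multiply on the right by `K = k(T*T)`,
where `k² x = β` for `x` within `δ` of `β` and `k` is uniformly close to `1`. -/
theorem mem_closure_AN_of_isCompactOperator_sub {T : E →L[ℂ] E} {β : ℝ} (hβ : 0 ≤ β)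
    (h : IsCompactOperator (adjoint T ∘L T - β • (1 : E →L[ℂ] E) : E →L[ℂ] E)) :
    T ∈ closure (AN E E) := by
  rcases hβ.eq_or_lt with rfl | hβ
  · refine subset_closure (isAbsolutelyNormAttaining_of_isCompactOperator_sub h fun M hM => ?_)
    have hM0 : M ≠ ⊥ := by
      rintro rfl
      exact hM inferInstance
    obtain ⟨x, hxM, hx0⟩ := M.exists_mem_ne_zero_of_ne_bot hM0
    exact ⟨x, hxM, hx0, by rw [zero_mul]; positivity⟩
  refine Metric.mem_closure_iff.2 fun ε hε => ?_
  set A := adjoint T ∘L T with hA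
  have hA0 : 0 ≤ A := adjoint_comp_self_nonneg T
  have hsa : IsSelfAdjoint A := .of_nonneg hA0
  set η := ε / (‖T‖ + 1) with hη
  have hη0 : 0 < η := by positivity
  -- The first bound keeps the clamped variable `c` at least `β/2`; with the second, `|1 - k| ≤ |1 -
  -- k²| = |c - β|/c ≤ η`.
  set δ := min (β / 2) (β * η / 2) with hδ
  have hδ0 : 0 < δ := by positivity
  have hδβ : δ ≤ β / 2 := min_le_left _ _
  have hδη : δ ≤ β * η / 2 := min_le_right _ _
  obtain ⟨c, hc⟩ : ∃ c : ℝ → ℝ, c = fun x => max (β - δ) (min (β + δ) x) := ⟨_, rfl⟩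
  have hcc : Continuous c := by rw [hc]; fun_prop
  have hc1 : ∀ x, β - δ ≤ c x := fun x => by rw [hc]; exact le_max_left _ _
  have hc2 : ∀ x, c x ≤ β + δ := fun x => by
    rw [hc]
    exact max_le (by linarith) (min_le_left _ _)
  have hc0 : ∀ x, 0 < c x := fun x => by linarith [hc1 x]
  obtain ⟨k, hk⟩ : ∃ k : ℝ → ℝ, k = fun x => √(β / c x) := ⟨_, rfl⟩
  have hkc : Continuous k := by
    rw [hk]
    exact (continuous_const.div hcc fun x => (hc0 x).ne').sqrt
  have hk2 : ∀ x, k x ^ 2 = β / c x := fun x => by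
    rw [hk]
    exact Real.sq_sqrt (div_nonneg hβ.le (hc0 x).le)
  have hk0 : ∀ x, 0 ≤ k x := fun x => by rw [hk]; exact Real.sqrt_nonneg _
  have hk1 : ∀ x, |1 - k x| ≤ η := by
    intro x
    have e1 : |1 - k x| ≤ |1 - k x ^ 2| := by
      have : 1 - k x ^ 2 = (1 - k x) * (1 + k x) := by ring
      rw [this, abs_mul]
      refine le_mul_of_one_le_right (abs_nonneg _) ?_
      rw [abs_of_nonneg (by linarith [hk0 x])]
      linarith [hk0 x]
    have e2 : 1 - k x ^ 2 = (c x - β) / c x := by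
      rw [hk2, sub_div, div_self (hc0 x).ne']
    have e3 : |c x - β| ≤ δ := by
      rw [abs_le]
      constructor <;> linarith [hc1 x, hc2 x]
    refine e1.trans ?_
    rw [e2, abs_div, abs_of_pos (hc0 x), div_le_iff₀ (hc0 x)]
    have e4 : η * (β / 2) ≤ η * c x := by
      gcongr
      linarith [hc1 x]
    linarith
  set K : E →L[ℂ] E := cfc k A with hK
  refine ⟨T * K, ?_, ?_⟩
  · refine isAbsolutelyNormAttaining_of_finiteDimensional_range (β := β) ?_
    have hKsa : star K = K := (cfc_predicate k A : IsSelfAdjoint K).star_eq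
    have heq : adjoint (T * K) ∘L (T * K) - β • (1 : E →L[ℂ] E) =
        cfc (fun x => k x * x * k x - β) A := by
      rw [cfc_sub (fun x => k x * x * k x) (fun _ => β) A (by fun_prop) (by fun_prop),
        cfc_mul (fun x => k x * x) k A (by fun_prop) (by fun_prop),
        cfc_mul k (fun x => x) A (by fun_prop) (by fun_prop), cfc_id' ℝ A, cfc_const β A,
        Algebra.algebraMap_eq_smul_one]
      change star (T * K) * (T * K) - _ = K * (star T * T) * K - _
      rw [star_mul, hKsa]
      noncomm_ring
    rw [heq]
    rw [← cfc_sub_const_eq hsa] at h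
    refine finiteDimensional_range_cfc (q := fun x => x - β) (by fun_prop) (by fun_prop) h hδ0
      fun x hx hxδ => ?_
    rw [abs_lt] at hxδ
    have hcx : c x = x := by
      rw [hc]
      dsimp only
      rw [min_eq_right (by linarith), max_eq_right (by linarith)]
    have hx0 : x ≠ 0 := by linarith
    have : k x * x * k x = k x ^ 2 * x := by ring
    rw [this, hk2, hcx, div_mul_cancel₀ _ hx0, sub_self]
  · have hsub : T - T * K = T * cfc (fun x => 1 - k x) A := by
      rw [cfc_sub (fun _ => (1 : ℝ)) k A (by fun_prop) (by fun_prop), cfc_const_one ℝ A, mul_sub,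
        mul_one]
    rw [dist_eq_norm, hsub]
    have hle : ‖cfc (fun x => 1 - k x) A‖ ≤ η := norm_cfc_le hη0.le fun x _ => hk1 x
    calc ‖T * cfc (fun x => 1 - k x) A‖ ≤ ‖T‖ * ‖cfc (fun x => 1 - k x) A‖ := norm_mul_le _ _
      _ ≤ ‖T‖ * η := by gcongr
      _ < (‖T‖ + 1) * η := by gcongr; linarith
      _ = ε := mul_div_cancel₀ _ (by positivity)

end CompactImpliesAN

/-! ### Compactness of adjoints -/

section AdjointCompact

variable {E : Type*} [NormedAddCommGroup E] [InnerProductSpace ℂ E] [CompleteSpace E]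

/-- With `A = T*T`, cut off by `g(A)`: `T(1 - g(A))` has finite rank, since `g = 1` on `[0, ε²]`,
and `‖T g(A)‖² = ‖g(A) A g(A)‖ ≤ ε²`. -/
theorem isCompactOperator_of_adjoint_comp_self {T : E →L[ℂ] E}
    (h : IsCompactOperator (adjoint T ∘L T : E →L[ℂ] E)) : IsCompactOperator T := by
  set A := adjoint T ∘L T with hA
  have hA0 : 0 ≤ A := adjoint_comp_self_nonneg T
  have hsa : IsSelfAdjoint A := .of_nonneg hA0
  refine isCompactOperator_of_forall_norm_sub_le fun ε hε => ?_
  have hε2 : 0 < ε ^ 2 := sq_pos_of_pos hε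
  obtain ⟨g, hg⟩ : ∃ g : ℝ → ℝ, g = fun x => ε ^ 2 / max (ε ^ 2) x := ⟨_, rfl⟩
  have hpos : ∀ x, 0 < max (ε ^ 2) x := fun x => hε2.trans_le (le_max_left _ _)
  have hgc : Continuous g := by
    rw [hg]
    exact continuous_const.div (by fun_prop) fun x => (hpos x).ne'
  have hfin : FiniteDimensional ℂ (cfc (fun x => 1 - g x) A).range := by
    refine finiteDimensional_range_cfc (q := fun x => x) (by fun_prop) (by fun_prop)
      (by rwa [cfc_id' ℝ A]) hε2 fun x hx hxε => ?_
    rw [hg]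
    dsimp only
    rw [max_eq_left (le_of_abs_le hxε.le), div_self hε2.ne', sub_self]
  refine ⟨T * cfc (fun x => 1 - g x) A,
    (isCompactOperator_of_finiteDimensional_range hfin).clm_comp T, ?_⟩
  have hsub : T - T * cfc (fun x => 1 - g x) A = T * cfc g A := by
    rw [cfc_sub (fun _ => (1 : ℝ)) g A (by fun_prop) (by fun_prop), cfc_const_one ℝ A]
    noncomm_ring
  rw [hsub]
  have hgsa : star (cfc g A) = cfc g A := (cfc_predicate g A : IsSelfAdjoint (cfc g A)).star_eq
  have heq : star (T * cfc g A) * (T * cfc g A) = cfc (fun x => g x * x * g x) A := by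
    rw [cfc_mul (fun x => g x * x) g A (by fun_prop) (by fun_prop),
      cfc_mul g (fun x => x) A (by fun_prop) (by fun_prop), cfc_id' ℝ A, star_mul, hgsa]
    change _ = cfc g A * (star T * T) * cfc g A
    noncomm_ring
  refine le_of_sq_le_sq ?_ hε.le
  rw [sq, ← CStarRing.norm_star_mul_self, heq]
  refine norm_cfc_le hε2.le fun x hx => ?_
  have hx0 : 0 ≤ x := spectrum_nonneg_of_nonneg hA0 hx
  have hg0 : 0 ≤ g x := by rw [hg]; exact div_nonneg hε2.le (hpos x).le
  have hg1 : g x ≤ 1 := by rw [hg]; exact (div_le_one (hpos x)).2 (le_max_left _ _)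
  have hgx : g x * x ≤ ε ^ 2 := by
    rw [hg]
    dsimp only
    rw [div_mul_eq_mul_div, div_le_iff₀ (hpos x)]
    gcongr
    exact le_max_right _ _
  rw [Real.norm_of_nonneg (by positivity)]
  exact (mul_le_of_le_one_right (by positivity) hg1).trans hgx

theorem isCompactOperator_adjoint {T : E →L[ℂ] E} (h : IsCompactOperator T) :
    IsCompactOperator (adjoint T) := by
  refine isCompactOperator_of_adjoint_comp_self ?_
  rw [adjoint_adjoint]
  exact h.comp_clm (adjoint T)

end AdjointCompact

/-! ### Block operators and compact perturbations -/

section Block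

variable {H₁ H₂ : Type*} [NormedAddCommGroup H₁] [InnerProductSpace ℂ H₁]
  [NormedAddCommGroup H₂] [InnerProductSpace ℂ H₂]

theorem blockOperator_add (A₁₁ B₁₁ : H₁ →L[ℂ] H₁) (A₁₂ B₁₂ : H₂ →L[ℂ] H₁)
    (A₂₁ B₂₁ : H₁ →L[ℂ] H₂) (A₂₂ B₂₂ : H₂ →L[ℂ] H₂) :
    blockOperator (A₁₁ + B₁₁) (A₁₂ + B₁₂) (A₂₁ + B₂₁) (A₂₂ + B₂₂) =
      blockOperator A₁₁ A₁₂ A₂₁ A₂₂ + blockOperator B₁₁ B₁₂ B₂₁ B₂₂ := by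
  ext1 x
  change WithLp.toLp 2 (A₁₁ x.fst + B₁₁ x.fst + (A₁₂ x.snd + B₁₂ x.snd),
      A₂₁ x.fst + B₂₁ x.fst + (A₂₂ x.snd + B₂₂ x.snd)) =
    WithLp.toLp 2 (A₁₁ x.fst + A₁₂ x.snd, A₂₁ x.fst + A₂₂ x.snd) +
      WithLp.toLp 2 (B₁₁ x.fst + B₁₂ x.snd, B₂₁ x.fst + B₂₂ x.snd)
  rw [← WithLp.toLp_add, Prod.mk_add_mk, add_add_add_comm, add_add_add_comm (A₂₁ x.fst)]

theorem isCompactOperator_blockOperator {A₁₁ : H₁ →L[ℂ] H₁} {A₁₂ : H₂ →L[ℂ] H₁}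
    {A₂₁ : H₁ →L[ℂ] H₂} {A₂₂ : H₂ →L[ℂ] H₂} (h₁₁ : IsCompactOperator A₁₁)
    (h₁₂ : IsCompactOperator A₁₂) (h₂₁ : IsCompactOperator A₂₁) (h₂₂ : IsCompactOperator A₂₂) :
    IsCompactOperator (blockOperator A₁₁ A₁₂ A₂₁ A₂₂) := by
  set L := WithLp.prodContinuousLinearEquiv 2 ℂ H₁ H₂
  set P := ContinuousLinearMap.fst ℂ H₁ H₂ ∘L L.toContinuousLinearMap
  set Q := ContinuousLinearMap.snd ℂ H₁ H₂ ∘L L.toContinuousLinearMap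
  set I := L.symm.toContinuousLinearMap ∘L ContinuousLinearMap.inl ℂ H₁ H₂
  set J := L.symm.toContinuousLinearMap ∘L ContinuousLinearMap.inr ℂ H₁ H₂
  have h := (((h₁₁.comp_clm P).add (h₁₂.comp_clm Q)).clm_comp I).add
    (((h₂₁.comp_clm P).add (h₂₂.comp_clm Q)).clm_comp J)
  have heq : ⇑(blockOperator A₁₁ A₁₂ A₂₁ A₂₂) =
      ⇑I ∘ (⇑A₁₁ ∘ ⇑P + ⇑A₁₂ ∘ ⇑Q) + ⇑J ∘ (⇑A₂₁ ∘ ⇑P + ⇑A₂₂ ∘ ⇑Q) := by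
    funext x
    change WithLp.toLp 2 (A₁₁ x.fst + A₁₂ x.snd, A₂₁ x.fst + A₂₂ x.snd) =
      WithLp.toLp 2 (A₁₁ x.fst + A₁₂ x.snd, (0 : H₂)) +
        WithLp.toLp 2 ((0 : H₁), A₂₁ x.fst + A₂₂ x.snd)
    rw [← WithLp.toLp_add, Prod.mk_add_mk, add_zero, zero_add]
  rw [heq]
  exact h

variable [CompleteSpace H₁] [CompleteSpace H₂]

theorem adjoint_comp_blockOperator_diag_sub (A₁₁ : H₁ →L[ℂ] H₁) (A₂₂ : H₂ →L[ℂ] H₂) (β : ℝ) :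
    adjoint (blockOperator A₁₁ 0 0 A₂₂) ∘L blockOperator A₁₁ 0 0 A₂₂ -
        β • (1 : WithLp 2 (H₁ × H₂) →L[ℂ] WithLp 2 (H₁ × H₂)) =
      blockOperator (adjoint A₁₁ ∘L A₁₁ - β • (1 : H₁ →L[ℂ] H₁)) 0 0
        (adjoint A₂₂ ∘L A₂₂ - β • (1 : H₂ →L[ℂ] H₂)) := by
  ext1 x
  refine ext_inner_right ℂ fun y => ?_
  set D := blockOperator A₁₁ 0 0 A₂₂ with hD
  have hDx : ∀ x, D x = WithLp.toLp 2 (A₁₁ x.fst, A₂₂ x.snd) := fun x => by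
    change WithLp.toLp 2 (A₁₁ x.fst + (0 : H₁), (0 : H₂) + A₂₂ x.snd) = _
    rw [add_zero, zero_add]
  change ⟪adjoint D (D x) - (β : ℂ) • x, y⟫_ℂ =
    ⟪WithLp.toLp 2 (adjoint A₁₁ (A₁₁ x.fst) - (β : ℂ) • x.fst + (0 : H₁),
      (0 : H₂) + (adjoint A₂₂ (A₂₂ x.snd) - (β : ℂ) • x.snd)), y⟫_ℂ
  rw [inner_sub_left, adjoint_inner_left, hDx, hDx, inner_smul_left, WithLp.prod_inner_apply,
    WithLp.prod_inner_apply, WithLp.prod_inner_apply, add_zero, zero_add]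
  change ⟪A₁₁ x.fst, A₁₁ y.fst⟫_ℂ + ⟪A₂₂ x.snd, A₂₂ y.snd⟫_ℂ -
      (starRingEnd ℂ) β * (⟪x.fst, y.fst⟫_ℂ + ⟪x.snd, y.snd⟫_ℂ) =
    ⟪adjoint A₁₁ (A₁₁ x.fst) - (β : ℂ) • x.fst, y.fst⟫_ℂ +
      ⟪adjoint A₂₂ (A₂₂ x.snd) - (β : ℂ) • x.snd, y.snd⟫_ℂ
  rw [inner_sub_left, inner_sub_left, adjoint_inner_left, adjoint_inner_left, inner_smul_left,
    inner_smul_left]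
  ring

/-- Expanding the product, every term beyond `D*D - βI` contains `C` or `C*` as a factor. -/
theorem isCompactOperator_adjoint_comp_add_sub {E : Type*} [NormedAddCommGroup E]
    [InnerProductSpace ℂ E] [CompleteSpace E] {D C : E →L[ℂ] E} {β : ℝ}
    (hD : IsCompactOperator (adjoint D ∘L D - β • (1 : E →L[ℂ] E) : E →L[ℂ] E))
    (hC : IsCompactOperator C) :
    IsCompactOperator (adjoint (D + C) ∘L (D + C) - β • (1 : E →L[ℂ] E) : E →L[ℂ] E) := by
  have heq : adjoint (D + C) ∘L (D + C) - β • (1 : E →L[ℂ] E) =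
      (adjoint D ∘L D - β • (1 : E →L[ℂ] E)) + adjoint (D + C) ∘L C + adjoint C ∘L D := by
    rw [map_add]
    change (adjoint D + adjoint C) * (D + C) - _ =
      adjoint D * D - _ + (adjoint D + adjoint C) * C + adjoint C * D
    noncomm_ring
  rw [heq]
  exact (hD.add (hC.clm_comp (adjoint (D + C)))).add ((isCompactOperator_adjoint hC).comp_clm D)

end Block

end BlockAN

theorem mainTheorem12 {H₁ H₂ : Type*}
    [NormedAddCommGroup H₁] [InnerProductSpace ℂ H₁] [CompleteSpace H₁]
    [TopologicalSpace.SeparableSpace H₁]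
    [NormedAddCommGroup H₂] [InnerProductSpace ℂ H₂] [CompleteSpace H₂]
    [TopologicalSpace.SeparableSpace H₂]
    (hH₁ : ¬ FiniteDimensional ℂ H₁) (hH₂ : ¬ FiniteDimensional ℂ H₂)
    (A₁₁ : H₁ →L[ℂ] H₁) (A₁₂ : H₂ →L[ℂ] H₁) (A₂₁ : H₁ →L[ℂ] H₂) (A₂₂ : H₂ →L[ℂ] H₂)
    (hA₁₁ : A₁₁ ∈ closure (BlockAN.AN H₁ H₁)) (hA₂₂ : A₂₂ ∈ closure (BlockAN.AN H₂ H₂))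
    (hess : BlockAN.essentialSpectrum (BlockAN.modulus A₁₁) =
      BlockAN.essentialSpectrum (BlockAN.modulus A₂₂))
    (hA₁₂ : IsCompactOperator A₁₂) (hA₂₁ : IsCompactOperator A₂₁) :
    BlockAN.blockOperator A₁₁ A₁₂ A₂₁ A₂₂ ∈
      closure (BlockAN.AN (WithLp 2 (H₁ × H₂)) (WithLp 2 (H₁ × H₂))) := by
  obtain ⟨β, hβ, h₁⟩ := BlockAN.exists_isCompactOperator_sub_of_mem_closure hA₁₁
  obtain ⟨γ, hγ, h₂⟩ := BlockAN.exists_isCompactOperator_sub_of_mem_closure hA₂₂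
  obtain rfl : β = γ := BlockAN.eq_of_essentialSpectrum_eq hH₁ (BlockAN.modulus_nonneg A₁₁)
    (BlockAN.modulus_nonneg A₂₂) hess hβ hγ (by rwa [BlockAN.modulus_mul_self])
    (by rwa [BlockAN.modulus_mul_self])
  refine BlockAN.mem_closure_AN_of_isCompactOperator_sub hβ ?_
  have hsplit : BlockAN.blockOperator A₁₁ A₁₂ A₂₁ A₂₂ =
      BlockAN.blockOperator A₁₁ 0 0 A₂₂ + BlockAN.blockOperator 0 A₁₂ A₂₁ 0 := by
    rw [← BlockAN.blockOperator_add]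
    simp
  rw [hsplit]
  refine BlockAN.isCompactOperator_adjoint_comp_add_sub ?_
    (BlockAN.isCompactOperator_blockOperator isCompactOperator_zero hA₁₂ hA₂₁
      isCompactOperator_zero)
  rw [BlockAN.adjoint_comp_blockOperator_diag_sub]
  exact BlockAN.isCompactOperator_blockOperator h₁ isCompactOperator_zero isCompactOperator_zero h₂
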